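/- Let $n,m\ge 0$ be integers. Let $H=T^*$ be the hyperplane line bundle on $\mathbb P^n(\mathbb C)$, the dual of the tautological bundle $T$, and let $H^m$ be its $m$-th tensor power with the Hermitian metric induced from $\mathbb C^{n+1}$. In the affine chart $[1:z_1:\dots:z_n]\mapsto z\in\mathbb C^n$, and in the corresponding standard trivialization of $H^m$, the space $L_2(\mathbb P^n(\mathbb C),H^m)$ is $L_2(\mathbb C^n,\nu_m)$, where $$d\nu_m(z)=\frac{(n+m)!}{\pi^n\,m!}\,\frac{dV(z)}{(1+|z_1|^2+\dots+|z_n|^2)^{n+m+1}}$$ and $dV$ is Lebesgue measure. The weighted Bergman space $\mathcal A^2_m(\mathbb P^n(\mathbb C))$ is the subspace of $L_2(\mathbb P^n(\mathbb C),H^m)$ consisting of the global holomorphic sections of $H^m$, and $B_m$ is the orthogonal projection of $L_2(\mathbb P^n(\mathbb C),H^m)$ onto it. For a bounded measurable function $a:\mathbb C^n\to\mathbb C$, the Toeplitz operator $T_a$ on $\mathcal A^2_m(\mathbb P^n(\mathbb C))$ is $T_a\psi=B_m(a\psi)$. The symbol $a$ is separately radial if $a(z)$ depends only on $(|z_1|,\dots,|z_n|)$.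 Let $J_n(m)=\{p\in\mathbb Z_{\ge0}^n: |p|=p_1+\dots+p_n\le m\}$, $p!=p_1!\cdots p_n!$, $z^p=z_1^{p_1}\cdots z_n^{p_n}$. **Theorem.** The normalized monomials $\left(\frac{m!}{p!\,(m-|p|)!}\right)^{1/2}z^p$, $p\in J_n(m)$, form an orthonormal basis of $\mathcal A^2_m(\mathbb P^n(\mathbb C))$, and the map $$R:\mathcal A^2_m(\mathbb P^n(\mathbb C))\to \ell_2(J_n(m)),\qquad R\psi=\left\{\left(\tfrac{m!}{p!\,(m-|p|)!}\right)^{1/2}\int_{\mathbb C^n}\psi(z)\,\overline{z}^{\,p}\,d\nu_m(z)\right\}_{p\in J_n(m)},$$ where the integrals converge absolutely, is unitary, with adjoint $$R^*:\{c_p\}_{p\in J_n(m)}\mapsto\sum_{p\in J_n(m)}\left(\tfrac{m!}{p!\,(m-|p|)!}\right)^{1/2}c_p\,z^p .$$ Let $a$ be a bounded measurable separately radial function. Then $RT_aR^*$ is the operator of multiplication by the sequence $\gamma_{a,m}=\{\gamma_{a,m}(p)\}_{p\in J_n(m)}$ on $\ell_2(J_n(m))$, where $$\gamma_{a,m}(p)=\frac{2^n\,(n+m)!}{p!\,(m-|p|)!}\int_{\mathbb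 R^n_+}\frac{a(r_1,\dots,r_n)\,r_1^{2p_1+1}\cdots r_n^{2p_n+1}\,dr_1\cdots dr_n}{(1+r_1^2+\dots+r_n^2)^{n+m+1}},$$ and the integral converges absolutely. Equivalently, $T_a$ is diagonal in the orthonormal basis of normalized monomials: $$T_a\left(\left(\tfrac{m!}{p!\,(m-|p|)!}\right)^{1/2}z^p\right)=\gamma_{a,m}(p)\left(\tfrac{m!}{p!\,(m-|p|)!}\right)^{1/2}z^p,\qquad p\in J_n(m).$$ Consequently $T_aT_b=T_bT_a$ on $\mathcal A^2_m(\mathbb P^n(\mathbb C))$ for all bounded measurable separately radial $a,b$. -/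

import Mathlib

open MeasureTheory Filter Topology
open scoped ENNReal ComplexConjugate BigOperators Nat LinearAlgebra.Projectivization

noncomputable section

namespace ToeplitzPn

/-! ### Projective space, its affine charts, and the powers of the hyperplane bundle -/

/-- Complex projective space `P^n(ℂ)`, the set of lines through `0` in `ℂ^(n+1)`. -/
abbrev PN (n : ℕ) : Type := ℙ ℂ (Fin (n + 1) → ℂ)

/-- The vector `(z_1, …, 1, …, z_n)` with entry `1` in place `j`. -/
def affineVec {n : ℕ} (j : Fin (n + 1)) (z : Fin n → ℂ) : Fin (n + 1) → ℂ :=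
  Fin.insertNth (α := fun _ => ℂ) j 1 z

lemma affineVec_ne_zero {n : ℕ} (j : Fin (n + 1)) (z : Fin n → ℂ) : affineVec j z ≠ 0 := by
  intro h
  have := congrFun h j
  simp [affineVec] at this

/-- The inverse `φ_j⁻¹ : ℂ^n → U_j ⊆ P^n(ℂ)` of the `j`-th affine chart. -/
def chartInv {n : ℕ} (j : Fin (n + 1)) (z : Fin n → ℂ) : PN n :=
  Projectivization.mk ℂ (affineVec j z) (affineVec_ne_zero j z)

lemma mem_submodule_mk {n : ℕ} (w : Fin (n + 1) → ℂ) (hw : w ≠ 0) :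
    w ∈ (Projectivization.mk ℂ w hw).submodule := by
  rw [Projectivization.submodule_mk]
  exact Submodule.mem_span_singleton_self w

/-- The fibre at the line `x` of `H^m`, where `H = T^*` is the dual of the tautological line
bundle `T` (so `T_x = x` as a line in `ℂ^(n+1)`). As `x` is finite-dimensional,
`(T_x^*)^{⊗ m}` is the space of `m`-linear forms on `x`. -/
abbrev HFiber (n m : ℕ) (x : PN n) : Type :=
  MultilinearMap ℂ (fun _ : Fin m => x.submodule) ℂ

/-- All (set-theoretic) sections of `H^m` over `P^n(ℂ)`. -/
abbrev HSection (n m : ℕ) : Type := (x : PN n) → HFiber n m x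

/-- The expression of a section of `H^m` in the standard trivialisation over `U_j` and the chart
`φ_j`. The frame of `H^m` over `U_j` is the `m`-th power of the `j`-th coordinate functional,
which is `1` on `affineVec j z`. These trivialisations have transition functions
`(w_k / w_j)^m`. -/
def trivCoord {n m : ℕ} (j : Fin (n + 1)) : HSection n m →ₗ[ℂ] ((Fin n → ℂ) → ℂ) where
  toFun ζ z := ζ (chartInv j z) fun _ => ⟨affineVec j z, mem_submodule_mk _ _⟩
  map_add' _ _ := rfl
  map_smul' _ _ := rfl

/-- `Γ_hol(P^n(ℂ), H^m)`: the global sections that are holomorphic in every standard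
trivialisation. -/
def holSections (n m : ℕ) : Submodule ℂ (HSection n m) where
  carrier := {ζ | ∀ j, Differentiable ℂ (trivCoord j ζ)}
  add_mem' {ζ ξ} hζ hξ j := by
    rw [map_add]
    exact (hζ j).add (hξ j)
  zero_mem' j := by
    rw [map_zero]
    exact differentiable_const 0
  smul_mem' c ζ hζ j := by
    rw [map_smul]
    exact (hζ j).const_smul c

/-! ### The weighted measure and the space of square-integrable sections -/

/-- The weighted measure on `P^n(ℂ)` in the affine chart `φ_0`:
`dν_m(z) = (n+m)! / (π^n m!) · dV(z) / (1 + |z_1|² + ⋯ + |z_n|²)^(n+m+1)`. -/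
def nu (n m : ℕ) : Measure (Fin n → ℂ) :=
  (volume : Measure (Fin n → ℂ)).withDensity fun z =>
    ENNReal.ofReal (((n + m)! : ℝ) / (Real.pi ^ n * (m ! : ℝ)) /
      (1 + ∑ i, ‖z i‖ ^ 2) ^ (n + m + 1))

/-- `L_2(P^n(ℂ), H^m)`, written in the trivialisation of `H^m` over `U_0`: the complement of `U_0`
is a null set, and the fibre metric of `H^m` at `φ_0⁻¹(z)` is `(1 + |z|²)^(-m)`, which is part of
the weight of `ν_m`. -/
abbrev L2 (n m : ℕ) : Type := Lp ℂ 2 (nu n m)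

/-- The weighted Bergman space `A²_m(P^n(ℂ))`: the elements of `L_2(P^n(ℂ), H^m)` that are given
by a holomorphic section of `H^m` over all of `P^n(ℂ)`. -/
def bergman (n m : ℕ) : Submodule ℂ (L2 n m) where
  carrier := {f | ∃ ζ ∈ holSections n m, ⇑f =ᵐ[nu n m] trivCoord 0 ζ}
  add_mem' := by
    rintro f g ⟨ζ, hζ, hf⟩ ⟨ξ, hξ, hg⟩
    refine ⟨ζ + ξ, add_mem hζ hξ, ?_⟩
    rw [map_add]
    exact (Lp.coeFn_add f g).trans (hf.add hg)
  zero_mem' := by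
    refine ⟨0, zero_mem _, ?_⟩
    rw [map_zero]
    exact Lp.coeFn_zero ℂ 2 (nu n m)
  smul_mem' := by
    rintro c f ⟨ζ, hζ, hf⟩
    refine ⟨c • ζ, Submodule.smul_mem _ c hζ, ?_⟩
    rw [map_smul]
    exact (Lp.coeFn_smul c f).trans (hf.const_smul c)

/-! ### The Bergman space is finite-dimensional, so that it has an orthogonal projection -/

lemma affineVec_self {n : ℕ} (j : Fin (n + 1)) (z : Fin n → ℂ) : affineVec j z j = 1 := by
  simp [affineVec]

lemma trivCoord_change {n m : ℕ} (ζ : HSection n m) (j k : Fin (n + 1)) (z z' : Fin n → ℂ)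
    (c : ℂ) (hc : affineVec j z = c • affineVec k z') :
    trivCoord j ζ z = c ^ m * trivCoord k ζ z' := by
  have hx : chartInv j z = chartInv k z' := by
    unfold chartInv
    rw [Projectivization.mk_eq_mk_iff']
    exact ⟨c, hc.symm⟩
  have key : ∀ (x y : PN n) (_ : x = y) (v w : Fin (n + 1) → ℂ) (hv : v ∈ x.submodule)
      (hw : w ∈ y.submodule), v = c • w →
      (ζ x fun _ => ⟨v, hv⟩) = c ^ m * ζ y fun _ => ⟨w, hw⟩ := by
    rintro x y rfl v w hv hw rfl
    have := (ζ x).map_smul_univ (fun _ : Fin m => c) (fun _ => ⟨w, hw⟩)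
    simpa using this
  exact key _ _ hx _ _ _ _ hc

lemma tendsto_inv_cocompact_complex :
    Tendsto (fun t : ℂ => t⁻¹) (cocompact ℂ) (𝓝 0) := by
  rw [← Metric.cobounded_eq_cocompact]
  exact tendsto_inv₀_cobounded

lemma entire_eq_zero (m : ℕ) : ∀ (g : ℂ → ℂ), Differentiable ℂ g →
    (∃ c, Tendsto (fun t => g t / t ^ m) (cocompact ℂ) (𝓝 c)) →
    (∀ k : ℕ, k ≤ m → g k = 0) → ∀ t, g t = 0 := by
  induction m with
  | zero =>
    rintro g hg ⟨c, hc⟩ h0 t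
    have hc' : Tendsto g (cocompact ℂ) (𝓝 c) := by simpa using hc
    have h1 := hg.apply_eq_of_tendsto_cocompact t hc'
    have h2 := hg.apply_eq_of_tendsto_cocompact 0 hc'
    have h3 := h0 0 le_rfl
    rw [h1, ← h2]
    simpa using h3
  | succ m ih =>
    rintro g hg ⟨c, hc⟩ h0 t
    set a : ℂ := ((m + 1 : ℕ) : ℂ) with ha
    have hga : g a = 0 := h0 (m + 1) le_rfl
    have hd : Differentiable ℂ (dslope g a) := by
      rw [← differentiableOn_univ]
      exact (Complex.differentiableOn_dslope univ_mem).2 hg.differentiableOn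
    have hs : ∀ t, (t - a) * dslope g a t = g t := by
      intro t
      have := sub_smul_dslope g a t
      simpa [hga] using this
    have hz : ∀ t, dslope g a t = 0 := by
      refine ih _ hd ⟨c, ?_⟩ ?_
      · have h1 : Tendsto (fun t : ℂ => t⁻¹) (cocompact ℂ) (𝓝 0) := tendsto_inv_cocompact_complex
        have h2 : Tendsto (fun t : ℂ => (1 - a * t⁻¹)⁻¹) (cocompact ℂ) (𝓝 1) := by
          have h3 : Tendsto (fun t : ℂ => 1 - a * t⁻¹) (cocompact ℂ) (𝓝 1) := by
            simpa using (h1.const_mul a).const_sub 1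
          simpa using h3.inv₀ one_ne_zero
        have h4 := hc.mul h2
        rw [mul_one] at h4
        refine h4.congr' ?_
        have hne : ∀ b : ℂ, ∀ᶠ t in cocompact ℂ, t ≠ b := fun b =>
          (isCompact_singleton (x := b)).compl_mem_cocompact
        filter_upwards [hne 0, hne a] with t ht0 hta
        have hta' : t - a ≠ 0 := sub_ne_zero.2 hta
        rw [← hs t]
        have h5 : 1 - a * t⁻¹ = (t - a) / t := by field_simp
        rw [h5]
        field_simp
        ring
      · intro k hk
        have h1 := hs k
        rw [h0 k (hk.trans (Nat.le_succ m))] at h1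
        rcases mul_eq_zero.1 h1 with h2 | h2
        · exfalso
          rw [sub_eq_zero, ha, Nat.cast_inj] at h2
          omega
        · exact h2
    rw [← hs t, hz t, mul_zero]

lemma continuous_affineVec {n : ℕ} (j : Fin (n + 1)) :
    Continuous (fun z : Fin n → ℂ => affineVec j z) := by
  unfold affineVec
  exact continuous_const.finInsertNth j continuous_id

lemma holSection_line {n m : ℕ} {ζ : HSection n m} (hζ : ζ ∈ holSections n m) (z : Fin n → ℂ)
    (i : Fin n) (h0 : ∀ k : ℕ, k ≤ m → trivCoord 0 ζ (Function.update z i k) = 0) (t : ℂ) :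
    trivCoord 0 ζ (Function.update z i t) = 0 := by
  refine entire_eq_zero m (fun t => trivCoord 0 ζ (Function.update z i t)) ?_ ?_ h0 t
  · refine (hζ 0).comp ?_
    rw [differentiable_pi]
    intro k
    by_cases hk : k = i
    · subst hk
      simp
    · simp [Function.update_of_ne hk]
  · -- on the other chart the point depends continuously on `s = t⁻¹`, up to `s = 0`
    let v : ℂ → Fin (n + 1) → ℂ := fun s =>
      Function.update (s • affineVec 0 z) i.succ 1
    let y : ℂ → Fin n → ℂ := fun s => i.succ.removeNth (v s)
    have hy : Continuous y := by
      refine continuous_pi fun k => ?_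
      have hv : Continuous v := by
        have : Continuous fun s : ℂ => s • affineVec 0 z := continuous_id.smul continuous_const
        exact this.update i.succ continuous_const
      exact (continuous_apply (i.succ.succAbove k)).comp hv
    have hF : Tendsto (fun t : ℂ => trivCoord i.succ ζ (y t⁻¹)) (cocompact ℂ)
        (𝓝 (trivCoord i.succ ζ (y 0))) :=
      (((hζ i.succ).continuous.comp hy).tendsto 0).comp tendsto_inv_cocompact_complex
    refine ⟨_, hF.congr' ?_⟩
    filter_upwards [(isCompact_singleton (x := (0 : ℂ))).compl_mem_cocompact] with t ht
    have ht : t ≠ 0 := ht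
    have hv : affineVec i.succ (y t⁻¹) = v t⁻¹ := by
      have : v t⁻¹ i.succ = 1 := by simp [v]
      simp only [affineVec, y]
      rw [← this]
      exact Fin.insertNth_self_removeNth _ _
    have hc : affineVec 0 (Function.update z i t) = t • affineVec i.succ (y t⁻¹) := by
      rw [hv]
      funext k
      refine Fin.cases ?_ (fun k => ?_) k
      · simp [affineVec, v, Function.update_of_ne (Fin.succ_ne_zero i).symm, ht]
      · by_cases hk : k = i
        · subst hk
          simp [affineVec, v]
        · have hk' : k.succ ≠ i.succ := fun h => hk (Fin.succ_injective _ h)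
          simp [affineVec, v, Function.update_of_ne hk', ht]
    rw [trivCoord_change ζ 0 i.succ _ _ t hc]
    field_simp

lemma holSection_eq_zero {n m : ℕ} {ζ : HSection n m} (hζ : ζ ∈ holSections n m)
    (h0 : ∀ p : Fin n → Fin (m + 1), trivCoord 0 ζ (fun i => ((p i : ℕ) : ℂ)) = 0) :
    trivCoord 0 ζ = 0 := by
  have key : ∀ (s : Finset (Fin n)) (z : Fin n → ℂ),
      (∀ i ∉ s, ∃ k : ℕ, k ≤ m ∧ z i = k) → trivCoord 0 ζ z = 0 := by
    intro s
    induction s using Finset.induction_on with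
    | empty =>
      intro z hz
      choose p hp hpz using fun i => hz i (Finset.notMem_empty i)
      have := h0 fun i => ⟨p i, Nat.lt_succ_of_le (hp i)⟩
      rw [funext hpz]
      exact this
    | insert i s hi ih =>
      intro z hz
      have := holSection_line hζ z i (fun k hk => ih _ fun l hl => ?_) (z i)
      · simpa using this
      · by_cases hli : l = i
        · subst hli
          exact ⟨k, hk, by simp⟩
        · rw [Function.update_of_ne hli]
          exact hz l (by simp [hli, hl])
  funext z
  exact key Finset.univ z (fun i hi => absurd (Finset.mem_univ i) hi)

instance finiteDimensional_bergman (n m : ℕ) : FiniteDimensional ℂ (bergman n m) := by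
  let E : Submodule ℂ ((Fin n → ℂ) → ℂ) := (holSections n m).map (trivCoord 0)
  let ev : E →ₗ[ℂ] ((Fin n → Fin (m + 1)) → ℂ) :=
    { toFun := fun f p => f.1 (fun i => ((p i : ℕ) : ℂ))
      map_add' := fun _ _ => rfl
      map_smul' := fun _ _ => rfl }
  have hev : Function.Injective ev := by
    rw [injective_iff_map_eq_zero]
    rintro ⟨f, hf⟩ h
    obtain ⟨ζ, hζ, rfl⟩ := hf
    exact Subtype.ext (holSection_eq_zero hζ fun p => congrFun h p)
  have : FiniteDimensional ℂ E := FiniteDimensional.of_injective ev hev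
  let M : Submodule ℂ E :=
    { carrier := {f | MemLp f.1 2 (nu n m)}
      add_mem' := fun hf hg => hf.add hg
      zero_mem' := MemLp.zero
      smul_mem' := fun c _ hf => hf.const_smul c }
  let T : M →ₗ[ℂ] L2 n m :=
    { toFun := fun f => f.2.toLp
      map_add' := fun f g => MemLp.toLp_add f.2 g.2
      map_smul' := fun c f => MemLp.toLp_const_smul c f.2 }
  have hle : bergman n m ≤ LinearMap.range T := by
    rintro f ⟨ζ, hζ, hf⟩
    have hm : MemLp (trivCoord 0 ζ) 2 (nu n m) := (memLp_congr_ae hf).1 (Lp.memLp f)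
    refine ⟨⟨⟨trivCoord 0 ζ, ⟨ζ, hζ, rfl⟩⟩, hm⟩, ?_⟩
    apply Lp.ext
    exact (MemLp.coeFn_toLp hm).trans hf.symm
  exact Submodule.finiteDimensional_of_le hle

/-! ### Toeplitz operators -/

/-- Bounded measurable symbols. -/
def IsBoundedSymbol {n : ℕ} (a : (Fin n → ℂ) → ℂ) : Prop :=
  Measurable a ∧ ∃ C : ℝ, ∀ z, ‖a z‖ ≤ C

/-- `a` depends only on `|z_1|, …, |z_n|`. -/
def IsSeparatelyRadial {n : ℕ} (a : (Fin n → ℂ) → ℂ) : Prop :=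
  ∀ z w, (∀ i, ‖z i‖ = ‖w i‖) → a z = a w

lemma IsBoundedSymbol.memLp {n : ℕ} {a : (Fin n → ℂ) → ℂ} (ha : IsBoundedSymbol a) (m : ℕ) :
    MemLp a ∞ (nu n m) := by
  obtain ⟨h, C, hC⟩ := ha
  exact memLp_top_of_bound h.aestronglyMeasurable C (Eventually.of_forall hC)

/-- Multiplication by a bounded symbol on `L_2(P^n(ℂ), H^m)`, `f ↦ a f`. -/
def mulOp {n : ℕ} (m : ℕ) {a : (Fin n → ℂ) → ℂ} (ha : IsBoundedSymbol a) :
    L2 n m →L[ℂ] L2 n m :=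
  (ContinuousLinearMap.mul ℂ ℂ).holderL (nu n m) ∞ 2 2 (ha.memLp m).toLp

/-- The Toeplitz operator `T_a = B_m ∘ (multiplication by a)` on `A²_m(P^n(ℂ))`, where `B_m` is the
orthogonal projection of `L_2(P^n(ℂ), H^m)` onto `A²_m(P^n(ℂ))`. -/
def toeplitz {n : ℕ} (m : ℕ) {a : (Fin n → ℂ) → ℂ} (ha : IsBoundedSymbol a) :
    bergman n m →L[ℂ] bergman n m :=
  (bergman n m).orthogonalProjectionOnto ∘L mulOp m ha ∘L (bergman n m).subtypeL

/-! ### Monomials and the eigenvalue sequence -/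

/-- `J_n(m)`, the set of multi-indices `p ∈ ℕ^n` with `|p| ≤ m`. -/
abbrev J (n m : ℕ) : Type := {p : Fin n → ℕ // ∑ i, p i ≤ m}

instance finite_J (n m : ℕ) : Finite (J n m) := by
  refine Set.Finite.subset (Set.finite_Iic (fun _ : Fin n => m)) ?_
  intro p hp i
  exact (Finset.single_le_sum (fun j _ => Nat.zero_le (p j)) (Finset.mem_univ i)).trans hp

instance fintype_J (n m : ℕ) : Fintype (J n m) := Fintype.ofFinite _

/-- `p! (m - |p|)!`, where `p! = p_1! ⋯ p_n!`. -/
def indexFactorial {n m : ℕ} (p : J n m) : ℝ :=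
  (∏ i, ((p.1 i)! : ℝ)) * ((m - ∑ i, p.1 i)! : ℝ)

/-- `(m! / (p! (m - |p|)!))^(1/2)`. -/
def normConst {n m : ℕ} (p : J n m) : ℝ := Real.sqrt ((m ! : ℝ) / indexFactorial p)

/-- The monomial `z^p = z_1^{p_1} ⋯ z_n^{p_n}`. -/
def monomial {n m : ℕ} (p : J n m) (z : Fin n → ℂ) : ℂ := ∏ i, z i ^ p.1 i

/-- The integrand `a(r_1, …, r_n) r_1^{2p_1+1} ⋯ r_n^{2p_n+1} / (1 + r_1² + ⋯ + r_n²)^(n+m+1)`. -/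
def gammaIntegrand {n m : ℕ} (a : (Fin n → ℂ) → ℂ) (p : J n m) (r : Fin n → ℝ) : ℂ :=
  a (fun i => (r i : ℂ)) *
    (((∏ i, r i ^ (2 * p.1 i + 1)) / (1 + ∑ i, r i ^ 2) ^ (n + m + 1) : ℝ) : ℂ)

/-- The positive orthant `ℝ^n_+`. -/
def orthant (n : ℕ) : Set (Fin n → ℝ) := {r | ∀ i, 0 < r i}

/-- `γ_{a,m}(p) = 2^n (n+m)! / (p! (m-|p|)!) ∫_{ℝ^n_+} a(r) r^{2p+1} / (1+|r|²)^(n+m+1) dr`. -/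
def gammaSeq {n m : ℕ} (a : (Fin n → ℂ) → ℂ) (p : J n m) : ℂ :=
  (((2 : ℝ) ^ n * ((n + m)! : ℝ) / indexFactorial p : ℝ) : ℂ) *
    ∫ r in orthant n, gammaIntegrand a p r

end ToeplitzPn

end

namespace ToeplitzPn

/-! Two facts carry the proof. (1) In the chart `φ_0` the holomorphic sections of `H^m` are exactly
the polynomials of degree at most `m`. Homogenising a monomial to degree `m` gives a section
(`exists_holSection_monomial`). Conversely, the transition function to another chart bounds the
growth of a section on every affine line by `t ^ m` (`tendsto_holSection_line`). The Liouville
argument `entire_eq_zero` then makes it equal to its Lagrange interpolant there. Interpolating along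
coordinate lines shows that it is a polynomial, and lines through the origin bound the total degree
(`holSection_eq_sum_monomial`). (2) For separately radial `a` and normalised monomials `e_p`, the
integral of `a e_p conj(e_q)` against `ν_m` vanishes for `p ≠ q`, because `a` and `ν_m` are
invariant under the torus (`integral_symbol_mul_eq_zero`). For `p = q` polar coordinates turn it
into `γ_{a,m}(p)` (`integral_symbol_mul_normSq`). Taking `a = 1` and evaluating a Dirichlet integral
gives orthonormality, and (1) gives spanning. Since `B_m` is invisible in inner products with
elements of the Bergman space, (2) is the matrix of `T_a`, which is therefore diagonal; diagonal
operators commute. -/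

/-! ### Monomials as holomorphic sections of `H^m`. -/

lemma differentiable_affineVec_apply {n : ℕ} (j k : Fin (n + 1)) :
    Differentiable ℂ (fun z : Fin n → ℂ => affineVec j z k) := by
  rcases Fin.eq_self_or_eq_succAbove j k with rfl | ⟨i, rfl⟩
  · simp [affineVec]
  · simpa [affineVec] using differentiable_apply (𝕜 := ℂ) (F' := fun _ : Fin n => ℂ) i

/-- The exponents of the homogenisation of `z^p` to degree `m`. -/
def homogenizedExponent {n m : ℕ} (p : J n m) : Fin (n + 1) → ℕ :=
  Fin.cons (m - ∑ i, p.1 i) p.1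

lemma sum_homogenizedExponent {n m : ℕ} (p : J n m) : ∑ i, homogenizedExponent p i = m := by
  rw [Fin.sum_univ_succ]
  simpa [homogenizedExponent] using Nat.sub_add_cancel p.2

/-- Turns a homogeneous monomial of degree `m` into a product of `m` linear forms, as needed to
write it as an `m`-linear form on each line. -/
lemma exists_index {n m : ℕ} (p : J n m) : ∃ idx : Fin m → Fin (n + 1),
    ∀ v : Fin (n + 1) → ℂ, ∏ k, v (idx k) = ∏ i, v i ^ homogenizedExponent p i := by
  let e := finSigmaFinEquiv (n := homogenizedExponent p)
  refine ⟨fun k => (e.symm (Fin.cast (sum_homogenizedExponent p).symm k)).1, fun v => ?_⟩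
  have h1 := (finCongr (sum_homogenizedExponent p).symm).prod_comp (fun k => v (e.symm k).1)
  rw [e.symm.prod_comp (fun x => v x.1), Fintype.prod_sigma] at h1
  simpa using h1

/-- Every monomial of degree at most `m` is the local expression of a holomorphic section. -/
lemma exists_holSection_monomial {n m : ℕ} (p : J n m) :
    ∃ ζ ∈ holSections n m, trivCoord 0 ζ = monomial p := by
  obtain ⟨idx, hidx⟩ := exists_index p
  -- The product of the coordinate functionals selected by `idx`, restricted to the line `x`.
  let ζ : HSection n m := fun x =>
    (MultilinearMap.mkPiAlgebra ℂ (Fin m) ℂ).compLinearMap fun k =>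
      (LinearMap.proj (idx k)).comp x.submodule.subtype
  have hζ : ∀ j z, trivCoord j ζ z = ∏ i, affineVec j z i ^ homogenizedExponent p i := by
    intro j z
    rw [← hidx]
    simp [trivCoord, ζ]
  refine ⟨ζ, fun j => ?_, ?_⟩
  · rw [funext (hζ j)]
    exact fun z => (HasFDerivAt.finsetProd fun i _ =>
      ((differentiable_affineVec_apply j i).fun_pow (homogenizedExponent p i) z).hasFDerivAt
      ).differentiableAt
  · funext z
    rw [hζ, Fin.prod_univ_succ]
    simp [homogenizedExponent, affineVec, monomial]

/-! ### Holomorphic sections are polynomials of degree at most `m`. -/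

lemma eq_smul_affineVec_removeNth {n : ℕ} (j : Fin (n + 1)) (v : Fin (n + 1) → ℂ) (hv : v j ≠ 0) :
    v = v j • affineVec j (j.removeNth ((v j)⁻¹ • v)) := by
  funext k
  rcases Fin.eq_self_or_eq_succAbove j k with rfl | ⟨i, rfl⟩
  · simp [affineVec]
  · simp [affineVec, hv]

/-- A holomorphic section of `H^m` has a pole of order at most `m` at infinity along each affine
line. -/
lemma tendsto_holSection_line {n m : ℕ} {ζ : HSection n m} (hζ : ζ ∈ holSections n m)
    (z w : Fin n → ℂ) :
    ∃ c, Tendsto (fun t : ℂ => trivCoord 0 ζ (z + t • w) / t ^ m) (cocompact ℂ) (𝓝 c) := by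
  have hne : ∀ᶠ t : ℂ in cocompact ℂ, t ≠ 0 :=
    (isCompact_singleton (x := (0 : ℂ))).compl_mem_cocompact
  by_cases hw : w = 0
  · subst hw
    have h := (tendsto_inv_cocompact_complex.pow m).const_mul (trivCoord 0 ζ z)
    exact ⟨_, h.congr fun t => by simp [div_eq_mul_inv]⟩
  obtain ⟨i, hi⟩ := Function.ne_iff.1 hw
  -- For `s = t⁻¹` this is `t⁻¹ • affineVec 0 (z + t • w)`. It extends continuously to `s = 0`, the
  -- point at infinity of the line, which lies in `U_{i+1}` because `w i ≠ 0`.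
  let v : ℂ → Fin (n + 1) → ℂ := fun s => s • affineVec 0 z + Fin.cons 0 w
  have hv : Continuous v := (continuous_id.smul continuous_const).add continuous_const
  have hv0 : v 0 i.succ ≠ 0 := by simpa [v] using hi
  have hvi : Continuous fun s => v s i.succ := (continuous_apply _).comp hv
  let y : ℂ → Fin n → ℂ := fun s => i.succ.removeNth ((v s i.succ)⁻¹ • v s)
  have hy : ContinuousAt y 0 := by
    refine continuousAt_pi.2 fun k => ?_
    exact (hvi.continuousAt.inv₀ hv0).mul ((continuous_apply _).comp hv).continuousAt
  have hF : ContinuousAt (fun s => (v s i.succ) ^ m * trivCoord i.succ ζ (y s)) 0 :=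
    (hvi.continuousAt.pow m).mul ((hζ i.succ).continuous.continuousAt.comp hy)
  refine ⟨_, (hF.tendsto.comp tendsto_inv_cocompact_complex).congr' ?_⟩
  have hnv : ∀ᶠ t : ℂ in cocompact ℂ, v t⁻¹ i.succ ≠ 0 :=
    tendsto_inv_cocompact_complex.eventually (hvi.continuousAt.eventually_ne hv0)
  filter_upwards [hne, hnv] with t ht hvt
  have hc : affineVec 0 (z + t • w) = (t * v t⁻¹ i.succ) • affineVec i.succ (y t⁻¹) := by
    rw [mul_smul, ← eq_smul_affineVec_removeNth i.succ (v t⁻¹) hvt]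
    funext k
    refine Fin.cases ?_ (fun k => ?_) k
    · simp [affineVec, v, ht]
    · simp [affineVec, v, mul_add, ht]
  rw [trivCoord_change ζ 0 i.succ _ _ _ hc]
  rw [Function.comp_apply, mul_pow, mul_assoc, mul_div_cancel_left₀ _ (pow_ne_zero m ht)]

/-- Division by `t ^ m` leaves a polynomial in `t⁻¹`. This lets an interpolant be subtracted without
destroying the growth condition of `entire_eq_zero`. -/
lemma tendsto_polynomial_div_pow {Q : Polynomial ℂ} {m : ℕ} (hQ : Q.natDegree ≤ m) :
    ∃ c, Tendsto (fun t : ℂ => Q.eval t / t ^ m) (cocompact ℂ) (𝓝 c) := by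
  have hne : ∀ᶠ t : ℂ in cocompact ℂ, t ≠ 0 :=
    (isCompact_singleton (x := (0 : ℂ))).compl_mem_cocompact
  have h : Tendsto (fun t : ℂ => ∑ k ∈ Finset.range (m + 1), Q.coeff k * t⁻¹ ^ (m - k))
      (cocompact ℂ) (𝓝 (∑ k ∈ Finset.range (m + 1), Q.coeff k * 0 ^ (m - k))) :=
    tendsto_finsetSum _ fun k _ => (tendsto_inv_cocompact_complex.pow _).const_mul _
  refine ⟨_, h.congr' ?_⟩
  filter_upwards [hne] with t ht
  rw [Polynomial.eval_eq_sum_range' (Nat.lt_succ_of_le hQ), Finset.sum_div]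
  refine Finset.sum_congr rfl fun k hk => ?_
  have hk : k ≤ m := Nat.lt_succ_iff.1 (Finset.mem_range.1 hk)
  obtain ⟨l, rfl⟩ := Nat.exists_eq_add_of_le hk
  rw [Nat.add_sub_cancel_left, pow_add, inv_pow]
  field_simp

lemma injOn_natCast_range (m : ℕ) :
    Set.InjOn (fun k : ℕ => (k : ℂ)) (Finset.range (m + 1)) :=
  Nat.cast_injective.injOn

lemma natDegree_interpolate_le (m : ℕ) (r : ℕ → ℂ) :
    (Lagrange.interpolate (Finset.range (m + 1)) (fun k : ℕ => (k : ℂ)) r).natDegree ≤ m := by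
  refine Polynomial.natDegree_le_iff_degree_le.2 ?_
  have := Lagrange.degree_interpolate_le (r := r) (injOn_natCast_range m)
  rwa [Finset.card_range, Nat.add_sub_cancel] at this

/-- An entire function with a pole of order at most `m` at infinity is the Lagrange interpolation
polynomial at the nodes `0, …, m`. -/
lemma entire_eq_interpolate {m : ℕ} {g : ℂ → ℂ} (hg : Differentiable ℂ g)
    (hc : ∃ c, Tendsto (fun t => g t / t ^ m) (cocompact ℂ) (𝓝 c)) (t : ℂ) :
    g t = (Lagrange.interpolate (Finset.range (m + 1)) (fun k : ℕ => (k : ℂ))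
      fun k => g k).eval t := by
  set Q := Lagrange.interpolate (Finset.range (m + 1)) (fun k : ℕ => (k : ℂ)) fun k => g k with hQ
  have hdeg : Q.natDegree ≤ m := natDegree_interpolate_le m _
  obtain ⟨c, hc⟩ := hc
  obtain ⟨d, hd⟩ := tendsto_polynomial_div_pow hdeg
  refine sub_eq_zero.1 (entire_eq_zero m (fun t => g t - Q.eval t) (hg.sub Q.differentiable)
    ⟨c - d, ?_⟩ (fun k hk => ?_) t)
  · exact (hc.sub hd).congr fun t => (sub_div _ _ _).symm
  · rw [hQ, Lagrange.eval_interpolate_at_node (fun k : ℕ => g k) (injOn_natCast_range m)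
      (Finset.mem_range.2 (Nat.lt_succ_of_le hk)), sub_self]

/-- A function which is given by Lagrange interpolation in each variable of `s`, and does not depend
on the other variables, is a polynomial. -/
lemma exists_mvPolynomial_of_interpolate {n m : ℕ} (s : Finset (Fin n)) :
    ∀ f : (Fin n → ℂ) → ℂ,
      (∀ i ∈ s, ∀ z t, f (Function.update z i t) =
        (Lagrange.interpolate (Finset.range (m + 1)) (fun k : ℕ => (k : ℂ))
          fun k => f (Function.update z i k)).eval t) →
      (∀ i ∉ s, ∀ z t, f (Function.update z i t) = f z) →
      ∃ P : MvPolynomial (Fin n) ℂ, ∀ z, f z = MvPolynomial.eval z P := by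
  induction s using Finset.induction_on with
  | empty =>
    intro f _ hf
    -- `f` is constant: any point is reached from any other by changing one coordinate at a time.
    have key : ∀ (s : Finset (Fin n)) (z w : Fin n → ℂ), (∀ i ∉ s, z i = w i) → f z = f w := by
      intro s
      induction s using Finset.induction_on with
      | empty => intro z w h; rw [funext fun i => h i (Finset.notMem_empty i)]
      | insert i s hi ih =>
        intro z w h
        rw [← hf i (Finset.notMem_empty i) z (w i)]
        refine ih _ _ fun j hj => ?_
        by_cases hji : j = i
        · subst hji; simp
        · rw [Function.update_of_ne hji]
          exact h j (by simp [hji, hj])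
    exact ⟨MvPolynomial.C (f 0), fun z => by
      rw [MvPolynomial.eval_C]
      exact key Finset.univ _ _ fun i hi => absurd (Finset.mem_univ i) hi⟩
  | insert i s hi ih =>
    intro f h1 h2
    have hk : ∀ k : ℕ, ∃ P : MvPolynomial (Fin n) ℂ, ∀ z, f (Function.update z i k) =
        MvPolynomial.eval z P := by
      intro k
      -- Freezing the variable `i` at a node makes the function independent of it, so the induction
      -- hypothesis for `s` applies.
      refine ih (fun z => f (Function.update z i k)) (fun j hj z t => ?_) (fun j hj z t => ?_)
      · have hji : j ≠ i := fun h => hi (h ▸ hj)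
        have := h1 j (Finset.mem_insert_of_mem hj) (Function.update z i k) t
        simp only [Function.update_comm hji]
        exact this
      · by_cases hji : j = i
        · subst hji; simp
        · simp only [Function.update_comm hji]
          exact h2 j (by simp [hji, hj]) _ _
    choose P hP using hk
    let L : ℕ → MvPolynomial (Fin n) ℂ := fun k => Polynomial.aeval (MvPolynomial.X i)
      (Lagrange.basis (Finset.range (m + 1)) (fun k : ℕ => (k : ℂ)) k)
    refine ⟨∑ k ∈ Finset.range (m + 1), P k * L k, fun z => ?_⟩
    have hL : ∀ k, MvPolynomial.eval z (L k) =
        (Lagrange.basis (Finset.range (m + 1)) (fun k : ℕ => (k : ℂ)) k).eval (z i) := by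
      intro k
      have := Polynomial.hom_eval₂
        (Lagrange.basis (Finset.range (m + 1)) (fun k : ℕ => (k : ℂ)) k)
        (algebraMap ℂ (MvPolynomial (Fin n) ℂ)) (MvPolynomial.eval z) (MvPolynomial.X i)
      have hid : (MvPolynomial.eval z).comp (algebraMap ℂ (MvPolynomial (Fin n) ℂ)) =
          RingHom.id ℂ := by ext1 c; simp
      rw [hid, MvPolynomial.eval_X] at this
      exact this
    have := h1 i (Finset.mem_insert_self i s) z (z i)
    rw [Function.update_eq_self] at this
    rw [this, Lagrange.interpolate_apply, Polynomial.eval_finsetSum, map_sum]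
    refine Finset.sum_congr rfl fun k _ => ?_
    rw [Polynomial.eval_mul, Polynomial.eval_C, map_mul, hL, hP]

lemma eval_smul_of_isHomogeneous {n k : ℕ} {P : MvPolynomial (Fin n) ℂ} (hP : P.IsHomogeneous k)
    (t : ℂ) (z : Fin n → ℂ) :
    MvPolynomial.eval (t • z) P = t ^ k * MvPolynomial.eval z P := by
  rw [MvPolynomial.eval_eq', MvPolynomial.eval_eq', Finset.mul_sum]
  refine Finset.sum_congr rfl fun d hd => ?_
  have hd' : ∑ i, d i = k := by
    have := hP.degree_eq_sum_deg_support hd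
    rw [this]
    exact (Finset.sum_subset (Finset.subset_univ _) fun i _ hi => by simpa using hi).symm
  simp only [Pi.smul_apply, smul_eq_mul, mul_pow, Finset.prod_mul_distrib,
    Finset.prod_pow_eq_pow_sum, hd']
  ring

/-- A polynomial whose restriction to each line through the origin has degree at most `m` has total
degree at most `m`. -/
lemma totalDegree_le_of_line {n m : ℕ} {P : MvPolynomial (Fin n) ℂ}
    (h : ∀ z, ∃ Q : Polynomial ℂ, Q.natDegree ≤ m ∧
      ∀ t : ℂ, MvPolynomial.eval (t • z) P = Q.eval t) :
    P.totalDegree ≤ m := by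
  have hzero : ∀ k, m < k → MvPolynomial.homogeneousComponent k P = 0 := by
    intro k hk
    refine MvPolynomial.funext fun z => ?_
    obtain ⟨Q, hQ, hQt⟩ := h z
    -- Along the line `t • z`, the coefficient of `t ^ j` is the homogeneous component of degree `j`
    -- evaluated at `z`.
    have hQ' : Q = ∑ j ∈ Finset.range (P.totalDegree + 1), Polynomial.monomial j
        (MvPolynomial.eval z (MvPolynomial.homogeneousComponent j P)) := by
      refine Polynomial.funext fun t => ?_
      rw [← hQt, Polynomial.eval_finsetSum]
      conv_lhs => rw [← MvPolynomial.sum_homogeneousComponent P, map_sum]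
      refine Finset.sum_congr rfl fun j _ => ?_
      rw [eval_smul_of_isHomogeneous (MvPolynomial.homogeneousComponent_isHomogeneous j P),
        Polynomial.eval_monomial, mul_comm]
    by_cases hkP : k ∈ Finset.range (P.totalDegree + 1)
    · have h0 : Q.coeff k = 0 := Polynomial.coeff_eq_zero_of_natDegree_lt (hQ.trans_lt hk)
      rw [hQ', Polynomial.finsetSum_coeff] at h0
      simp only [Polynomial.coeff_monomial] at h0
      rw [Finset.sum_ite_eq' , if_pos hkP] at h0
      rw [h0, map_zero]
    · rw [MvPolynomial.homogeneousComponent_eq_zero _ _ (by simpa [Nat.lt_succ_iff] using hkP)]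
  by_contra! hlt
  have hP := MvPolynomial.sum_homogeneousComponent P
  obtain ⟨d, hd, hdeg⟩ := Finset.exists_mem_eq_sup P.support
    (by
      rw [MvPolynomial.support_nonempty]
      rintro rfl
      simp at hlt) (fun d => d.sum fun _ e => e)
  have h1 := congrArg (MvPolynomial.coeff d) (hzero d.degree (by
    have : d.degree = P.totalDegree := hdeg.symm
    omega))
  rw [MvPolynomial.coeff_homogeneousComponent, if_pos rfl, MvPolynomial.coeff_zero] at h1
  exact MvPolynomial.mem_support_iff.1 hd h1

lemma exists_eval_eq_sum_monomial {n m : ℕ} {P : MvPolynomial (Fin n) ℂ}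
    (hP : P.totalDegree ≤ m) :
    ∃ c : J n m → ℂ, ∀ z, MvPolynomial.eval z P = ∑ p, c p * monomial p z := by
  classical
  let toFin : J n m → (Fin n →₀ ℕ) := fun p => Finsupp.equivFunOnFinite.symm p.1
  have htoFin : Function.Injective toFin :=
    Finsupp.equivFunOnFinite.symm.injective.comp Subtype.val_injective
  refine ⟨fun p => MvPolynomial.coeff (toFin p) P, fun z => ?_⟩
  rw [MvPolynomial.eval_eq']
  have hsub : P.support ⊆ Finset.univ.image toFin := by
    intro d hd
    have h1 := (MvPolynomial.le_totalDegree hd).trans hP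
    rw [Finsupp.sum_fintype _ _ (fun _ => rfl)] at h1
    refine Finset.mem_image.2 ⟨⟨d, h1⟩, Finset.mem_univ _, ?_⟩
    exact Finsupp.equivFunOnFinite.symm_apply_apply d
  rw [Finset.sum_subset hsub (fun d _ hd => by
    rw [MvPolynomial.notMem_support_iff.1 hd, zero_mul]), Finset.sum_image htoFin.injOn]
  rfl

/-- The local expression of a holomorphic section of `H^m` is a combination of the monomials of
degree at most `m`. -/
lemma holSection_eq_sum_monomial {n m : ℕ} {ζ : HSection n m} (hζ : ζ ∈ holSections n m) :
    ∃ c : J n m → ℂ, ∀ z, trivCoord 0 ζ z = ∑ p, c p * monomial p z := by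
  have hline : ∀ z w : Fin n → ℂ, ∀ t : ℂ, trivCoord 0 ζ (z + t • w) =
      (Lagrange.interpolate (Finset.range (m + 1)) (fun k : ℕ => (k : ℂ))
        fun k => trivCoord 0 ζ (z + (k : ℂ) • w)).eval t := by
    intro z w t
    refine entire_eq_interpolate (g := fun t => trivCoord 0 ζ (z + t • w)) ?_
      (tendsto_holSection_line hζ z w) t
    exact (hζ 0).comp ((differentiable_const z).add (differentiable_id.smul_const w))
  -- Coordinate lines are affine lines, so `hline` provides the interpolation in each variable.
  have hup : ∀ (z : Fin n → ℂ) i (t : ℂ),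
      Function.update z i t = Function.update z i 0 + t • Pi.single i (1 : ℂ) := by
    intro z i t
    funext k
    by_cases hk : k = i
    · subst hk; simp
    · simp [hk]
  obtain ⟨P, hP⟩ := exists_mvPolynomial_of_interpolate (m := m) Finset.univ (trivCoord 0 ζ)
    (fun i _ z t => by
      simp only [hup z i t, fun k : ℕ => hup z i k]
      exact hline _ _ t)
    (fun i hi => absurd (Finset.mem_univ i) hi)
  have hdeg : P.totalDegree ≤ m := by
    refine totalDegree_le_of_line fun z =>
      ⟨Lagrange.interpolate (Finset.range (m + 1)) (fun k : ℕ => (k : ℂ))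
        fun k => trivCoord 0 ζ ((0 : Fin n → ℂ) + (k : ℂ) • z),
      natDegree_interpolate_le m _, fun t => ?_⟩
    rw [← hP, ← hline, zero_add]
  obtain ⟨c, hc⟩ := exists_eval_eq_sum_monomial hdeg
  exact ⟨c, fun z => (hP z).trans (hc z)⟩

/-! ### Polar coordinates and the image of `ν_m` under the moduli. -/

lemma orthant_eq_pi (n : ℕ) : orthant n = Set.univ.pi fun _ => Set.Ioi 0 := by
  ext r
  simp [orthant]

lemma measurableSet_orthant (n : ℕ) : MeasurableSet (orthant n) := by
  rw [orthant_eq_pi]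
  exact MeasurableSet.univ_pi fun _ => measurableSet_Ioi

/-- The map `z ↦ (|z_1|, …, |z_n|)`. -/
noncomputable def modulus {n : ℕ} (z : Fin n → ℂ) (i : Fin n) : ℝ := ‖z i‖

lemma measurable_modulus {n : ℕ} : Measurable (modulus (n := n)) :=
  measurable_pi_lambda _ fun i => (measurable_pi_apply i).norm

/-- Polar coordinates in each variable have Jacobian `∏ r_i`; the integrand ignores the angles,
whose box has volume `(2π)^n`. -/
lemma lintegral_comp_modulus {n : ℕ} {g : (Fin n → ℝ) → ℝ≥0∞} (hg : Measurable g) :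
    ∫⁻ z, g (modulus z) =
      ENNReal.ofReal (2 * Real.pi) ^ n *
        ∫⁻ r in orthant n, (∏ i, ENNReal.ofReal (r i)) * g r := by
  let e := MeasurableEquiv.arrowProdEquivProdArrow ℝ ℝ (Fin n)
  let S : Set ((Fin n → ℝ) × (Fin n → ℝ)) :=
    orthant n ×ˢ Set.univ.pi fun _ => Set.Ioo (-Real.pi) Real.pi
  have hT : MeasurableSet (Set.univ.pi fun _ : Fin n => Set.Ioo (-Real.pi) Real.pi) :=
    MeasurableSet.univ_pi fun _ => measurableSet_Ioo
  have hS : MeasurableSet S := (measurableSet_orthant n).prod hT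
  have hpre : (Set.univ.pi fun _ : Fin n => Complex.polarCoord.target) = e ⁻¹' S := by
    ext p
    simp [e, S, orthant, MeasurableEquiv.arrowProdEquivProdArrow, Equiv.arrowProdEquivProdArrow,
      Complex.polarCoord_target, forall_and]
  have hF : Measurable fun r : Fin n → ℝ => (∏ i, ENNReal.ofReal (r i)) * g r :=
    (Finset.measurable_fun_prod _ fun i _ => (measurable_pi_apply i).ennreal_ofReal).mul hg
  rw [← Complex.lintegral_comp_pi_polarCoord_symm]
  calc _ = ∫⁻ p in e ⁻¹' S, (fun q : (Fin n → ℝ) × (Fin n → ℝ) =>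
          (∏ i, ENNReal.ofReal (q.1 i)) * g q.1) (e p) := by
        rw [← hpre]
        refine setLIntegral_congr_fun (MeasurableSet.univ_pi fun _ =>
          Complex.polarCoord.open_target.measurableSet) fun p hp => ?_
        have : (modulus fun i => Complex.polarCoord.symm (p i)) = fun i => (p i).1 := by
          funext i
          have hi := (hp i trivial)
          rw [Complex.polarCoord_target] at hi
          rw [modulus, Complex.norm_polarCoord_symm, abs_of_pos hi.1]
        simp only [this]
        rfl
    _ = ∫⁻ q in S, (∏ i, ENNReal.ofReal (q.1 i)) * g q.1 :=
        (volume_measurePreserving_arrowProdEquivProdArrow ℝ ℝ (Fin n)).setLIntegral_comp_preimage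
          hS (hF.comp measurable_fst)
    _ = _ := by
        rw [Measure.volume_eq_prod, ← Measure.prod_restrict,
          lintegral_prod (fun q : (Fin n → ℝ) × (Fin n → ℝ) => (∏ i, ENNReal.ofReal (q.1 i)) * g q.1)
            (hF.comp measurable_fst).aemeasurable]
        simp only [lintegral_const, Measure.restrict_apply_univ]
        rw [lintegral_mul_const _ hF, mul_comm, volume_pi_pi]
        simp [two_mul]

/-- The density of the image of `ν_m` under `modulus`. -/
noncomputable def radialDensity (n m : ℕ) (r : Fin n → ℝ) : ℝ :=
  2 ^ n * ((n + m)! : ℝ) / (m ! : ℝ) * ((∏ i, r i) / (1 + ∑ i, r i ^ 2) ^ (n + m + 1))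

lemma measurable_radialDensity (n m : ℕ) : Measurable (radialDensity n m) := by
  unfold radialDensity
  fun_prop

lemma radialDensity_nonneg {n m : ℕ} {r : Fin n → ℝ} (hr : r ∈ orthant n) :
    0 ≤ radialDensity n m r := by
  have h1 : 0 ≤ ∏ i, r i := Finset.prod_nonneg fun i _ => (hr i).le
  have h2 : 0 ≤ ∑ i, r i ^ 2 := Finset.sum_nonneg fun i _ => sq_nonneg _
  unfold radialDensity
  positivity

/-- The angular factor `(2π)^n` meets the `π^n` in the denominator of `ν_m`, which leaves the `2^n`
of `γ_{a,m}`. -/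
lemma nu_map_modulus (n m : ℕ) :
    (nu n m).map modulus = (volume.restrict (orthant n)).withDensity
      fun r => ENNReal.ofReal (radialDensity n m r) := by
  refine Measure.ext_of_lintegral _ fun g hg => ?_
  let w : (Fin n → ℝ) → ℝ≥0∞ := fun r => ENNReal.ofReal
    (((n + m)! : ℝ) / (Real.pi ^ n * (m ! : ℝ)) / (1 + ∑ i, r i ^ 2) ^ (n + m + 1))
  have hw : Measurable w := by
    refine Measurable.ennreal_ofReal ?_
    fun_prop
  have hleft : ∫⁻ z, g (modulus z) ∂(nu n m) = ∫⁻ z, (w * g) (modulus z) :=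
    lintegral_withDensity_eq_lintegral_mul _ (hw.comp measurable_modulus)
      (hg.comp measurable_modulus)
  rw [lintegral_map hg measurable_modulus, hleft,
    lintegral_withDensity_eq_lintegral_mul _ (measurable_radialDensity n m).ennreal_ofReal hg]
  rw [lintegral_comp_modulus (hw.mul hg), ← lintegral_const_mul']
  swap
  · exact ENNReal.pow_ne_top ENNReal.ofReal_ne_top
  refine setLIntegral_congr_fun (measurableSet_orthant n) fun r hr => ?_
  have h1 : 0 ≤ ∏ i, r i := Finset.prod_nonneg fun i _ => (hr i).le
  have h2 : 0 < 1 + ∑ i, r i ^ 2 := by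
    have : 0 ≤ ∑ i, r i ^ 2 := Finset.sum_nonneg fun i _ => sq_nonneg _
    positivity
  simp only [Pi.mul_apply, w]
  rw [← mul_assoc, ← mul_assoc, ← ENNReal.ofReal_prod_of_nonneg fun i _ => (hr i).le,
    ← ENNReal.ofReal_pow (by positivity), ← ENNReal.ofReal_mul (by positivity),
    ← ENNReal.ofReal_mul (by positivity)]
  congr 2
  have := Real.pi_pos
  unfold radialDensity
  rw [mul_pow]
  field_simp

lemma integral_nu_comp_modulus {n m : ℕ} {F : (Fin n → ℝ) → ℂ} (hF : Measurable F) :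
    ∫ z, F (modulus z) ∂(nu n m) = ∫ r in orthant n, (radialDensity n m r : ℂ) * F r := by
  rw [← integral_map measurable_modulus.aemeasurable hF.aestronglyMeasurable, nu_map_modulus,
    integral_withDensity_eq_integral_toReal_smul (measurable_radialDensity n m).ennreal_ofReal
      (Eventually.of_forall fun _ => ENNReal.ofReal_lt_top)]
  refine setIntegral_congr_fun (measurableSet_orthant n) fun r hr => ?_
  rw [ENNReal.toReal_ofReal (radialDensity_nonneg hr), Complex.real_smul]

lemma integrable_nu_comp_modulus {n m : ℕ} {F : (Fin n → ℝ) → ℝ}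
    (h : IntegrableOn (fun r => radialDensity n m r * F r) (orthant n)) :
    Integrable (fun z => F (modulus z)) (nu n m) := by
  have : Integrable F ((nu n m).map modulus) := by
    rw [nu_map_modulus, integrable_withDensity_iff_integrable_smul'
      (measurable_radialDensity n m).ennreal_ofReal
      (Eventually.of_forall fun _ => ENNReal.ofReal_lt_top)]
    refine h.congr_fun (fun r hr => ?_) (measurableSet_orthant n)
    simp only
    rw [ENNReal.toReal_ofReal (radialDensity_nonneg hr), smul_eq_mul]
  exact this.comp_measurable measurable_modulus

/-! ### Gamma integrals and the Dirichlet integral over the orthant. -/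

lemma integral_pow_mul_exp_neg_mul (k : ℕ) {c : ℝ} (hc : 0 < c) :
    ∫ t in Set.Ioi (0 : ℝ), t ^ k * Real.exp (-(c * t)) = (k ! : ℝ) / c ^ (k + 1) := by
  have h := Real.integral_rpow_mul_exp_neg_mul_Ioi (a := (k : ℝ) + 1) (by positivity) hc
  rw [Real.Gamma_nat_eq_factorial, ← Nat.cast_add_one, Real.rpow_natCast] at h
  simp only [Nat.cast_add_one, add_sub_cancel_right, Real.rpow_natCast] at h
  rw [h, one_div, inv_pow, inv_mul_eq_div]

lemma integrableOn_pow_mul_exp_neg_mul (k : ℕ) {c : ℝ} (hc : 0 < c) :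
    IntegrableOn (fun t : ℝ => t ^ k * Real.exp (-(c * t))) (Set.Ioi 0) :=
  -- The Bochner integral of a non-integrable function is `0` by convention, so a nonzero value
  -- forces integrability.
  .of_integral_ne_zero (by rw [integral_pow_mul_exp_neg_mul k hc]; positivity)

lemma integral_odd_pow_mul_exp_neg_mul_sq (k : ℕ) {t : ℝ} (ht : 0 < t) :
    ∫ r in Set.Ioi (0 : ℝ), r ^ (2 * k + 1) * Real.exp (-t * r ^ 2) =
      (k ! : ℝ) / (2 * t ^ (k + 1)) := by
  have h := integral_rpow_mul_exp_neg_mul_rpow (p := 2) (q := ((2 * k + 1 : ℕ) : ℝ)) two_pos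
    (by have : (0 : ℝ) ≤ ((2 * k + 1 : ℕ) : ℝ) := Nat.cast_nonneg _
        linarith) ht
  have h1 : (((2 * k + 1 : ℕ) : ℝ) + 1) / 2 = (k : ℝ) + 1 := by push_cast; ring
  rw [neg_div, h1, Real.Gamma_nat_eq_factorial, Real.rpow_neg ht.le, ← Nat.cast_add_one,
    Real.rpow_natCast] at h
  simp only [Real.rpow_natCast, Real.rpow_two] at h
  rw [h]
  field_simp

lemma integrableOn_odd_pow_mul_exp_neg_mul_sq (k : ℕ) {t : ℝ} (ht : 0 < t) :
    IntegrableOn (fun r : ℝ => r ^ (2 * k + 1) * Real.exp (-t * r ^ 2)) (Set.Ioi 0) :=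
  .of_integral_ne_zero (by rw [integral_odd_pow_mul_exp_neg_mul_sq k ht]; positivity)

lemma restrict_orthant (n : ℕ) : (volume : Measure (Fin n → ℝ)).restrict (orthant n) =
    Measure.pi fun _ => volume.restrict (Set.Ioi 0) := by
  rw [orthant_eq_pi, volume_pi, Measure.restrict_pi_pi]

/-- The integrand of `gammaSeq 1`. -/
noncomputable def dirichletIntegrand {n m : ℕ} (p : J n m) (r : Fin n → ℝ) : ℝ :=
  (∏ i, r i ^ (2 * p.1 i + 1)) / (1 + ∑ i, r i ^ 2) ^ (n + m + 1)

lemma measurable_dirichletIntegrand {n m : ℕ} (p : J n m) : Measurable (dirichletIntegrand p) := by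
  unfold dirichletIntegrand
  fun_prop

lemma dirichletIntegrand_nonneg {n m : ℕ} (p : J n m) {r : Fin n → ℝ} (hr : r ∈ orthant n) :
    0 ≤ dirichletIntegrand p r := by
  have h1 : 0 ≤ ∏ i, r i ^ (2 * p.1 i + 1) := Finset.prod_nonneg fun i _ => pow_nonneg (hr i).le _
  have h2 : 0 ≤ ∑ i, r i ^ 2 := Finset.sum_nonneg fun i _ => sq_nonneg _
  unfold dirichletIntegrand
  positivity

lemma indexFactorial_pos {n m : ℕ} (p : J n m) : 0 < indexFactorial p := by
  unfold indexFactorial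
  have : 0 < ∏ i, ((p.1 i)! : ℝ) := Finset.prod_pos fun i _ => by positivity
  positivity

lemma lintegral_orthant_gaussian {n m : ℕ} (p : J n m) {t : ℝ} (ht : 0 < t) :
    ∫⁻ r in orthant n, ENNReal.ofReal ((∏ i, r i ^ (2 * p.1 i + 1)) *
        (t ^ (n + m) * Real.exp (-((1 + ∑ i, r i ^ 2) * t)))) =
      ENNReal.ofReal ((∏ i, ((p.1 i)! : ℝ)) / 2 ^ n *
        (t ^ (m - ∑ i, p.1 i) * Real.exp (-(1 * t)))) := by
  have hsplit : ∀ r : Fin n → ℝ, (∏ i, r i ^ (2 * p.1 i + 1)) *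
      (t ^ (n + m) * Real.exp (-((1 + ∑ i, r i ^ 2) * t))) =
      (t ^ (n + m) * Real.exp (-(1 * t))) *
        ∏ i, (r i ^ (2 * p.1 i + 1) * Real.exp (-t * r i ^ 2)) := by
    intro r
    rw [Finset.prod_mul_distrib, ← Real.exp_sum, ← Finset.mul_sum,
      show -((1 + ∑ i, r i ^ 2) * t) = -(1 * t) + -t * ∑ i, r i ^ 2 by ring, Real.exp_add]
    ring
  have hint : Integrable (fun r : Fin n → ℝ =>
      ∏ i, (r i ^ (2 * p.1 i + 1) * Real.exp (-t * r i ^ 2))) (volume.restrict (orthant n)) := by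
    rw [restrict_orthant]
    exact Integrable.fintype_prod
      (f := fun i (x : ℝ) => x ^ (2 * p.1 i + 1) * Real.exp (-t * x ^ 2))
      fun i => integrableOn_odd_pow_mul_exp_neg_mul_sq (p.1 i) ht
  simp only [hsplit]
  rw [← ofReal_integral_eq_lintegral_ofReal (hint.const_mul _)]
  · rw [integral_const_mul, restrict_orthant, integral_fintype_prod_eq_prod
      (fun i (x : ℝ) => x ^ (2 * p.1 i + 1) * Real.exp (-t * x ^ 2))]
    simp only [integral_odd_pow_mul_exp_neg_mul_sq _ ht]
    congr 1
    rw [Finset.prod_div_distrib, Finset.prod_mul_distrib, Finset.prod_pow_eq_pow_sum,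
      Finset.sum_add_distrib]
    simp only [Finset.prod_const, Finset.sum_const, Finset.card_univ, Fintype.card_fin,
      smul_eq_mul, mul_one]
    -- The `n` Gaussian integrals contribute `t ^ (-(|p| + n))`; the bound `|p| ≤ m` keeps the
    -- remaining exponent a natural number.
    have hm : t ^ (n + m) = t ^ (∑ i, p.1 i + n) * t ^ (m - ∑ i, p.1 i) := by
      rw [← pow_add]
      congr 1
      omega
    rw [hm]
    field_simp
  · refine (ae_restrict_iff' (measurableSet_orthant n)).2 (Eventually.of_forall fun r hr => ?_)
    have : 0 ≤ ∏ i, (r i ^ (2 * p.1 i + 1) * Real.exp (-t * r i ^ 2)) :=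
      Finset.prod_nonneg fun i _ => mul_nonneg (pow_nonneg (hr i).le _) (Real.exp_pos _).le
    simp only [Pi.zero_apply]
    positivity

/-- With `S = 1 + |r|²`, write `(n+m)! / S^(n+m+1)` as the integral of `t^(n+m) e^(-St)` over `t >
0` and exchange the integrals by Tonelli. The `r`-integral factors into Gaussian moments, and the
remaining `t`-integral is `(m - |p|)!`. -/
lemma lintegral_dirichletIntegrand {n m : ℕ} (p : J n m) :
    ∫⁻ r in orthant n, ENNReal.ofReal (dirichletIntegrand p r) =
      ENNReal.ofReal (indexFactorial p / (2 ^ n * ((n + m)! : ℝ))) := by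
  have h1 : ∀ r ∈ orthant n, ENNReal.ofReal (((n + m)! : ℝ) * dirichletIntegrand p r) =
      ∫⁻ t in Set.Ioi (0 : ℝ), ENNReal.ofReal ((∏ i, r i ^ (2 * p.1 i + 1)) *
        (t ^ (n + m) * Real.exp (-((1 + ∑ i, r i ^ 2) * t)))) := by
    intro r hr
    have h1 : 0 ≤ ∏ i, r i ^ (2 * p.1 i + 1) :=
      Finset.prod_nonneg fun i _ => pow_nonneg (hr i).le _
    have h2 : 0 < 1 + ∑ i, r i ^ 2 := by
      have : 0 ≤ ∑ i, r i ^ 2 := Finset.sum_nonneg fun i _ => sq_nonneg _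
      positivity
    rw [← ofReal_integral_eq_lintegral_ofReal
      ((integrableOn_pow_mul_exp_neg_mul (n + m) h2).const_mul _), integral_const_mul,
      integral_pow_mul_exp_neg_mul _ h2, dirichletIntegrand]
    · congr 1
      ring
    · refine (ae_restrict_iff' measurableSet_Ioi).2 (Eventually.of_forall fun t ht => ?_)
      have ht : 0 < t := ht
      simp only [Pi.zero_apply]
      positivity
  have hmeas : Measurable (Function.uncurry fun (r : Fin n → ℝ) (t : ℝ) =>
      ENNReal.ofReal ((∏ i, r i ^ (2 * p.1 i + 1)) *
        (t ^ (n + m) * Real.exp (-((1 + ∑ i, r i ^ 2) * t))))) := by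
    refine Measurable.ennreal_ofReal ?_
    fun_prop
  have h2 : ∫⁻ r in orthant n, ENNReal.ofReal (((n + m)! : ℝ) * dirichletIntegrand p r) =
      ENNReal.ofReal (indexFactorial p / 2 ^ n) := by
    rw [setLIntegral_congr_fun (measurableSet_orthant n) h1,
      lintegral_lintegral_swap hmeas.aemeasurable,
      setLIntegral_congr_fun measurableSet_Ioi fun t ht => lintegral_orthant_gaussian p ht]
    have h0 : 0 ≤ ∏ i, ((p.1 i)! : ℝ) := Finset.prod_nonneg fun i _ => by positivity
    rw [← ofReal_integral_eq_lintegral_ofReal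
      ((integrableOn_pow_mul_exp_neg_mul _ one_pos).const_mul _), integral_const_mul,
      integral_pow_mul_exp_neg_mul _ one_pos, indexFactorial]
    · congr 1
      simp only [one_pow, div_one]
      ring
    · refine (ae_restrict_iff' measurableSet_Ioi).2 (Eventually.of_forall fun t ht => ?_)
      have ht : 0 < t := ht
      simp only [Pi.zero_apply]
      positivity
  have hpos : (0 : ℝ) < ((n + m)! : ℝ) := by positivity
  simp only [ENNReal.ofReal_mul hpos.le] at h2
  rw [lintegral_const_mul' _ _ ENNReal.ofReal_ne_top] at h2
  rw [← div_div, ENNReal.ofReal_div_of_pos hpos, ← h2, mul_comm]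
  exact (ENNReal.mul_div_cancel_right (ENNReal.ofReal_pos.2 hpos).ne' ENNReal.ofReal_ne_top).symm

lemma integrableOn_dirichletIntegrand {n m : ℕ} (p : J n m) :
    IntegrableOn (dirichletIntegrand p) (orthant n) := by
  refine ⟨(measurable_dirichletIntegrand p).aestronglyMeasurable, ?_⟩
  rw [hasFiniteIntegral_iff_ofReal, lintegral_dirichletIntegrand]
  · exact ENNReal.ofReal_lt_top
  · exact (ae_restrict_iff' (measurableSet_orthant n)).2
      (Eventually.of_forall fun r hr => dirichletIntegrand_nonneg p hr)

lemma integral_dirichletIntegrand {n m : ℕ} (p : J n m) :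
    ∫ r in orthant n, dirichletIntegrand p r =
      indexFactorial p / (2 ^ n * ((n + m)! : ℝ)) := by
  have := indexFactorial_pos p
  rw [integral_eq_lintegral_of_nonneg_ae _
    (measurable_dirichletIntegrand p).aestronglyMeasurable, lintegral_dirichletIntegrand,
    ENNReal.toReal_ofReal (by positivity)]
  exact (ae_restrict_iff' (measurableSet_orthant n)).2
    (Eventually.of_forall fun r hr => dirichletIntegrand_nonneg p hr)

/-! ### Integrals of a radial symbol against pairs of monomials. -/

lemma isBoundedSymbol_one (n : ℕ) : IsBoundedSymbol fun _ : Fin n → ℂ => (1 : ℂ) :=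
  ⟨measurable_const, 1, fun _ => by simp⟩

lemma isSeparatelyRadial_one (n : ℕ) : IsSeparatelyRadial fun _ : Fin n → ℂ => (1 : ℂ) :=
  fun _ _ _ => rfl

lemma IsSeparatelyRadial.apply_modulus {n : ℕ} {a : (Fin n → ℂ) → ℂ} (h : IsSeparatelyRadial a)
    (z : Fin n → ℂ) : a (fun i => (modulus z i : ℂ)) = a z :=
  h _ _ fun i => by simp [modulus]

lemma IsBoundedSymbol.measurable_real {n : ℕ} {a : (Fin n → ℂ) → ℂ} (h : IsBoundedSymbol a) :
    Measurable fun r : Fin n → ℝ => a fun i => (r i : ℂ) :=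
  h.1.comp (measurable_pi_lambda _ fun i => Complex.measurable_ofReal.comp (measurable_pi_apply i))

lemma integrableOn_gammaIntegrand {n m : ℕ} {a : (Fin n → ℂ) → ℂ} (ha : IsBoundedSymbol a)
    (p : J n m) : IntegrableOn (gammaIntegrand a p) (orthant n) := by
  obtain ⟨C, hC⟩ := ha.2
  exact (integrableOn_dirichletIntegrand p).ofReal.bdd_mul
    ha.measurable_real.aestronglyMeasurable (Eventually.of_forall fun r => hC _)

/-- The normalised monomial. -/
noncomputable def normalizedMonomial {n m : ℕ} (p : J n m) (z : Fin n → ℂ) : ℂ :=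
  (normConst p : ℂ) * monomial p z

lemma measurable_normalizedMonomial {n m : ℕ} (p : J n m) :
    Measurable (normalizedMonomial p) := by
  unfold normalizedMonomial monomial
  fun_prop

lemma normConst_sq {n m : ℕ} (p : J n m) : normConst p ^ 2 = (m ! : ℝ) / indexFactorial p :=
  Real.sq_sqrt (div_nonneg (Nat.cast_nonneg _) (indexFactorial_pos p).le)

lemma normConst_ne_zero {n m : ℕ} (p : J n m) : (normConst p : ℂ) ≠ 0 :=
  Complex.ofReal_ne_zero.2
    (Real.sqrt_pos.2 (div_pos (by positivity) (indexFactorial_pos p))).ne'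

lemma norm_monomial {n m : ℕ} (p : J n m) (z : Fin n → ℂ) :
    ‖monomial p z‖ = ∏ i, modulus z i ^ p.1 i := by
  simp [monomial, modulus]

lemma radialDensity_mul {n m : ℕ} (p : J n m) (r : Fin n → ℝ) :
    radialDensity n m r * ∏ i, r i ^ (2 * p.1 i) =
      2 ^ n * ((n + m)! : ℝ) / (m ! : ℝ) * dirichletIntegrand p r := by
  unfold radialDensity dirichletIntegrand
  simp only [pow_succ, Finset.prod_mul_distrib]
  ring

lemma memLp_normalizedMonomial {n m : ℕ} (p : J n m) :
    MemLp (normalizedMonomial p) 2 (nu n m) := by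
  rw [memLp_two_iff_integrable_sq_norm (measurable_normalizedMonomial p).aestronglyMeasurable]
  have h : Integrable (fun z => ∏ i, modulus z i ^ (2 * p.1 i)) (nu n m) := by
    refine integrable_nu_comp_modulus (F := fun r => ∏ i, r i ^ (2 * p.1 i)) ?_
    simp only [radialDensity_mul]
    exact (integrableOn_dirichletIntegrand p).const_mul _
  refine (h.const_mul (‖(normConst p : ℂ)‖ ^ 2)).congr (Eventually.of_forall fun z => ?_)
  simp only [normalizedMonomial, norm_mul, norm_monomial, mul_pow, ← Finset.prod_pow, ← pow_mul,
    mul_comm 2]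

lemma integral_symbol_mul_normSq {n m : ℕ} {a : (Fin n → ℂ) → ℂ} (ha : IsBoundedSymbol a)
    (hr : IsSeparatelyRadial a) (p : J n m) :
    ∫ z, a z * normalizedMonomial p z * conj (normalizedMonomial p z) ∂(nu n m) =
      gammaSeq a p := by
  let F : (Fin n → ℝ) → ℂ := fun r => a (fun i => (r i : ℂ)) *
    ((normConst p ^ 2 * ∏ i, r i ^ (2 * p.1 i) : ℝ) : ℂ)
  have hF : Measurable F := by
    refine ha.measurable_real.mul (Complex.measurable_ofReal.comp ?_)
    fun_prop
  have h1 : ∀ z, a z * normalizedMonomial p z * conj (normalizedMonomial p z) =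
      F (modulus z) := by
    intro z
    simp only [F]
    rw [mul_assoc, Complex.mul_conj, hr.apply_modulus, Complex.normSq_eq_norm_sq,
      normalizedMonomial, norm_mul, norm_monomial, mul_pow, Complex.norm_real, Real.norm_eq_abs,
      sq_abs, ← Finset.prod_pow]
    simp only [← pow_mul, mul_comm 2]
  rw [integral_congr_ae (Eventually.of_forall h1), integral_nu_comp_modulus hF, gammaSeq,
    ← integral_const_mul]
  refine setIntegral_congr_fun (measurableSet_orthant n) fun r _ => ?_
  have h2 : radialDensity n m r * (normConst p ^ 2 * ∏ i, r i ^ (2 * p.1 i)) =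
      (2 : ℝ) ^ n * ((n + m)! : ℝ) / indexFactorial p * dirichletIntegrand p r := by
    rw [mul_left_comm, radialDensity_mul, normConst_sq]
    have : (0 : ℝ) < (m ! : ℝ) := by positivity
    field_simp
  simp only [gammaIntegrand, F]
  rw [mul_left_comm, ← Complex.ofReal_mul, h2, Complex.ofReal_mul, mul_left_comm]
  rfl

/-- The Dirichlet integral is the reciprocal of the prefactor of `gammaSeq`; this is what gives the
normalised monomials norm one. -/
lemma gammaSeq_one {n m : ℕ} (p : J n m) :
    gammaSeq (fun _ : Fin n → ℂ => (1 : ℂ)) p = 1 := by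
  have h : ∀ r : Fin n → ℝ, gammaIntegrand (fun _ => (1 : ℂ)) p r =
      ((dirichletIntegrand p r : ℝ) : ℂ) := fun r => one_mul _
  have := indexFactorial_pos p
  simp only [gammaSeq, h]
  rw [integral_complex_ofReal, integral_dirichletIntegrand, ← Complex.ofReal_mul]
  norm_cast
  field_simp

/-- `ν_m` is invariant under rotations of the coordinates. -/
lemma integral_nu_rotate {n m : ℕ} (c : Fin n → Circle) (f : (Fin n → ℂ) → ℂ) :
    ∫ z, f (fun i => c i * z i) ∂(nu n m) = ∫ z, f z ∂(nu n m) := by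
  let e := MeasurableEquiv.piCongrRight fun i : Fin n =>
    (rotation (c i)).toHomeomorph.toMeasurableEquiv
  have he : MeasurePreserving e :=
    volume_preserving_pi fun i => (rotation (c i)).measurePreserving
  have hw : Measurable fun z : Fin n → ℂ => ENNReal.ofReal (((n + m)! : ℝ) /
      (Real.pi ^ n * (m ! : ℝ)) / (1 + ∑ i, ‖z i‖ ^ 2) ^ (n + m + 1)) := by
    refine Measurable.ennreal_ofReal ?_
    fun_prop
  have hez : ∀ z, e z = fun i => (c i : ℂ) * z i := fun z => rfl
  unfold nu
  rw [integral_withDensity_eq_integral_toReal_smul hw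
      (Eventually.of_forall fun _ => ENNReal.ofReal_lt_top),
    integral_withDensity_eq_integral_toReal_smul hw
      (Eventually.of_forall fun _ => ENNReal.ofReal_lt_top),
    ← he.integral_comp' (g := fun z : Fin n → ℂ =>
      (ENNReal.ofReal (((n + m)! : ℝ) / (Real.pi ^ n * (m ! : ℝ)) /
        (1 + ∑ i, ‖z i‖ ^ 2) ^ (n + m + 1))).toReal • f z)]
  simp only [hez, norm_mul, Circle.norm_coe, one_mul]

lemma integral_symbol_mul_eq_zero {n m : ℕ} {a : (Fin n → ℂ) → ℂ}
    (hr : IsSeparatelyRadial a) {p q : J n m} (hpq : p ≠ q) :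
    ∫ z, a z * normalizedMonomial p z * conj (normalizedMonomial q z) ∂(nu n m) = 0 := by
  obtain ⟨i, hi⟩ : ∃ i, p.1 i ≠ q.1 i := Function.ne_iff.1 fun h => hpq (Subtype.ext h)
  -- Rotating `z_i` by `θ` multiplies `e_p conj(e_q)` by `exp(iθ(p_i - q_i)) = -1`, so the invariant
  -- integral equals its own negative.
  let θ : ℝ := Real.pi / ((p.1 i : ℝ) - q.1 i)
  let c : Fin n → Circle := Function.update 1 i (Circle.exp θ)
  have hmono : ∀ (s : J n m) (z : Fin n → ℂ), normalizedMonomial s (fun j => (c j : ℂ) * z j) =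
      (Circle.exp θ : ℂ) ^ s.1 i * normalizedMonomial s z := by
    intro s z
    have h1 : ∏ j, (c j : ℂ) ^ s.1 j = (Circle.exp θ : ℂ) ^ s.1 i := by
      rw [Finset.prod_eq_single i]
      · simp [c]
      · intro j _ hj
        simp [c, hj]
      · simp
    simp only [normalizedMonomial, monomial, mul_pow, Finset.prod_mul_distrib, h1]
    ring
  have hu : (Circle.exp θ : ℂ) ^ p.1 i * conj ((Circle.exp θ : ℂ) ^ q.1 i) = -1 := by
    have hne : ((p.1 i : ℝ) - q.1 i) ≠ 0 := sub_ne_zero.2 (by exact_mod_cast hi)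
    rw [map_pow, ← Circle.coe_inv_eq_conj, ← Circle.exp_neg, Circle.coe_exp, Circle.coe_exp,
      ← Complex.exp_nat_mul, ← Complex.exp_nat_mul, ← Complex.exp_add, ← Complex.exp_pi_mul_I]
    congr 1
    have h2 : (Real.pi : ℂ) = ((p.1 i : ℝ) - q.1 i : ℝ) * θ := by
      rw [← Complex.ofReal_mul, mul_div_cancel₀ _ hne]
    rw [h2]
    push_cast
    ring
  have h := integral_nu_rotate (m := m) c
    fun z => a z * normalizedMonomial p z * conj (normalizedMonomial q z)
  have h3 : ∀ z : Fin n → ℂ, a (fun j => (c j : ℂ) * z j) *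
      normalizedMonomial p (fun j => (c j : ℂ) * z j) *
      conj (normalizedMonomial q (fun j => (c j : ℂ) * z j)) =
      -1 * (a z * normalizedMonomial p z * conj (normalizedMonomial q z)) := by
    intro z
    rw [hr (fun j => (c j : ℂ) * z j) z (fun j => by
      rw [norm_mul, Circle.norm_coe, one_mul]), hmono, hmono, map_mul, ← hu]
    ring
  simp only [h3] at h
  rw [integral_const_mul, neg_one_mul] at h
  exact self_eq_neg.1 h.symm

/-! ### The orthonormal basis and the diagonal form of `T_a`. -/

/-- The normalised monomial as an element of the Bergman space. -/
noncomputable def basisVector {n m : ℕ} (p : J n m) : bergman n m :=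
  ⟨(memLp_normalizedMonomial p).toLp (normalizedMonomial p), by
    obtain ⟨ζ, hζ, h⟩ := exists_holSection_monomial p
    refine ⟨(normConst p : ℂ) • ζ, Submodule.smul_mem _ _ hζ, ?_⟩
    rw [map_smul, h]
    exact (memLp_normalizedMonomial p).coeFn_toLp⟩

lemma coeFn_basisVector {n m : ℕ} (p : J n m) :
    ⇑(basisVector p : L2 n m) =ᵐ[nu n m] normalizedMonomial p :=
  (memLp_normalizedMonomial p).coeFn_toLp

lemma coeFn_mulOp {n m : ℕ} {a : (Fin n → ℂ) → ℂ} (ha : IsBoundedSymbol a) (f : L2 n m) :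
    ⇑(mulOp m ha f) =ᵐ[nu n m] fun z => a z * f z := by
  have h := (ContinuousLinearMap.mul ℂ ℂ).coeFn_holder (r := 2) (ha.memLp m).toLp f
  filter_upwards [h, (ha.memLp m).coeFn_toLp] with z h1 h2
  rw [← h2]
  exact h1

/-- Both orthonormality (`a = 1`) and the eigenvalues of `T_a` are read off from this matrix. The
inner product is conjugate-linear in its first argument, hence `q` stands first. -/
lemma inner_mulOp_basisVector {n m : ℕ} {a : (Fin n → ℂ) → ℂ} (ha : IsBoundedSymbol a)
    (hr : IsSeparatelyRadial a) (p q : J n m) :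
    inner ℂ (basisVector q : L2 n m) (mulOp m ha (basisVector p)) =
      if p = q then gammaSeq a p else 0 := by
  have h : inner ℂ (basisVector q : L2 n m) (mulOp m ha (basisVector p)) =
      ∫ z, a z * normalizedMonomial p z * conj (normalizedMonomial q z) ∂(nu n m) := by
    rw [L2.inner_def]
    refine integral_congr_ae ?_
    filter_upwards [coeFn_mulOp ha (basisVector p : L2 n m), coeFn_basisVector p,
      coeFn_basisVector q] with z h1 h2 h3
    rw [h1, h2, h3]
    rfl
  rw [h]
  split_ifs with hpq
  · subst hpq
    exact integral_symbol_mul_normSq ha hr p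
  · exact integral_symbol_mul_eq_zero hr hpq

lemma orthonormal_basisVector (n m : ℕ) : Orthonormal ℂ (basisVector : J n m → bergman n m) := by
  classical
  rw [orthonormal_iff_ite]
  intro q p
  have h1 := inner_mulOp_basisVector (isBoundedSymbol_one n) (isSeparatelyRadial_one n) p q
  have h2 : mulOp m (isBoundedSymbol_one n) (basisVector p) = (basisVector p : L2 n m) := by
    refine Lp.ext ((coeFn_mulOp _ _).trans (Eventually.of_forall fun z => one_mul _))
  rw [h2, gammaSeq_one] at h1
  rw [Submodule.coe_inner, h1]
  simp [eq_comm]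

lemma coeFn_sum_smul_basisVector {n m : ℕ} (c : J n m → ℂ) :
    ⇑((∑ p, c p • basisVector p : bergman n m) : L2 n m) =ᵐ[nu n m]
      fun z => ∑ p, (normConst p : ℂ) * c p * monomial p z := by
  have h : ((∑ p, c p • basisVector p : bergman n m) : L2 n m) =
      ∑ p, c p • (basisVector p : L2 n m) := by simp
  rw [h]
  have h1 := Lp.coeFn_finsetSum (p := 2) (μ := nu n m) Finset.univ fun p : J n m =>
    c p • (basisVector p : L2 n m)
  have h2 : ∀ p : J n m, ⇑(c p • (basisVector p : L2 n m)) =ᵐ[nu n m]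
      fun z => (normConst p : ℂ) * c p * monomial p z := by
    intro p
    filter_upwards [Lp.coeFn_smul (c p) (basisVector p : L2 n m), coeFn_basisVector p]
      with z h3 h4
    rw [h3, Pi.smul_apply, h4, normalizedMonomial, smul_eq_mul]
    ring
  filter_upwards [h1, ae_all_iff.2 h2] with z h3 h4
  rw [h3, Finset.sum_apply]
  exact Finset.sum_congr rfl fun p _ => h4 p

lemma span_basisVector (n m : ℕ) :
    ⊤ ≤ Submodule.span ℂ (Set.range (basisVector : J n m → bergman n m)) := by
  rintro ⟨f, ζ, hζ, hf⟩ -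
  obtain ⟨c, hc⟩ := holSection_eq_sum_monomial hζ
  have h : (⟨f, ζ, hζ, hf⟩ : bergman n m) =
      ∑ p, ((normConst p : ℂ)⁻¹ * c p) • basisVector p := by
    refine Subtype.ext (Lp.ext (hf.trans ?_))
    refine EventuallyEq.trans (Eventually.of_forall fun z => ?_)
      (coeFn_sum_smul_basisVector _).symm
    rw [hc]
    refine Finset.sum_congr rfl fun p _ => ?_
    rw [mul_inv_cancel_left₀ (normConst_ne_zero p)]
  rw [h]
  exact Submodule.sum_mem _ fun p _ =>
    Submodule.smul_mem _ _ (Submodule.subset_span (Set.mem_range_self p))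

/-- The orthonormal basis of normalised monomials of the Bergman space. -/
noncomputable def monomialBasis (n m : ℕ) : OrthonormalBasis (J n m) ℂ (bergman n m) :=
  OrthonormalBasis.mk (orthonormal_basisVector n m) (span_basisVector n m)

lemma monomialBasis_apply {n m : ℕ} (p : J n m) : monomialBasis n m p = basisVector p := by
  simp [monomialBasis]

lemma toeplitz_basisVector {n m : ℕ} {a : (Fin n → ℂ) → ℂ} (ha : IsBoundedSymbol a)
    (hr : IsSeparatelyRadial a) (p : J n m) :
    toeplitz m ha (basisVector p) = gammaSeq a p • basisVector p := by
  classical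
  refine (monomialBasis n m).toBasis.ext_elem fun q => ?_
  rw [OrthonormalBasis.coe_toBasis_repr_apply, OrthonormalBasis.coe_toBasis_repr_apply, map_smul,
    ← monomialBasis_apply, OrthonormalBasis.repr_self, monomialBasis_apply,
    OrthonormalBasis.repr_apply_apply, monomialBasis_apply]
  have h1 : inner ℂ (basisVector q) (toeplitz m ha (basisVector p)) =
      inner ℂ (basisVector q : L2 n m) (mulOp m ha (basisVector p)) :=
    -- `B_m` drops out because the other argument already lies in the Bergman space.
    Submodule.inner_orthogonalProjectionOnto_eq_of_mem_left _ _
  rw [h1, inner_mulOp_basisVector ha hr]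
  simp [eq_comm]

lemma repr_toeplitz {n m : ℕ} {a : (Fin n → ℂ) → ℂ} (ha : IsBoundedSymbol a)
    (hr : IsSeparatelyRadial a) (c : EuclideanSpace ℂ (J n m)) (p : J n m) :
    (monomialBasis n m).repr (toeplitz m ha ((monomialBasis n m).repr.symm c)) p =
      gammaSeq a p * c p := by
  have h : toeplitz m ha ((monomialBasis n m).repr.symm c) =
      (monomialBasis n m).repr.symm (WithLp.toLp 2 fun p => gammaSeq a p * c p) := by
    rw [← OrthonormalBasis.sum_repr_symm, ← OrthonormalBasis.sum_repr_symm, map_sum]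
    refine Finset.sum_congr rfl fun q _ => ?_
    rw [map_smul, monomialBasis_apply, toeplitz_basisVector ha hr, smul_smul, mul_comm]
  rw [h, LinearIsometryEquiv.apply_symm_apply]

end ToeplitzPn

theorem mainTheorem1 (n m : ℕ) :
    ∃ (R : ToeplitzPn.bergman n m ≃ₗᵢ[ℂ] EuclideanSpace ℂ (ToeplitzPn.J n m))
      (e : OrthonormalBasis (ToeplitzPn.J n m) ℂ (ToeplitzPn.bergman n m)),
      -- `R` is given by `ψ ↦ (c_p ∫ ψ(z) conj(z^p) dν_m(z))_p`, an absolutely convergent integral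
      (∀ (ψ : ToeplitzPn.bergman n m) (p : ToeplitzPn.J n m),
        Integrable (fun z => (ψ : ToeplitzPn.L2 n m) z * conj (ToeplitzPn.monomial p z))
          (ToeplitzPn.nu n m) ∧
        R ψ p = (ToeplitzPn.normConst p : ℂ) *
          ∫ z, (ψ : ToeplitzPn.L2 n m) z * conj (ToeplitzPn.monomial p z)
            ∂(ToeplitzPn.nu n m)) ∧
      -- its adjoint (inverse) is given by `(c_p)_p ↦ ∑_p (m! / (p! (m-|p|)!))^(1/2) c_p z^p`
      (∀ c : EuclideanSpace ℂ (ToeplitzPn.J n m),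
        ⇑(R.symm c : ToeplitzPn.L2 n m) =ᵐ[ToeplitzPn.nu n m]
          fun z => ∑ p, (ToeplitzPn.normConst p : ℂ) * c p * ToeplitzPn.monomial p z) ∧
      -- `e` is the basis of normalised monomials
      (∀ p : ToeplitzPn.J n m,
        ⇑(e p : ToeplitzPn.L2 n m) =ᵐ[ToeplitzPn.nu n m]
          fun z => (ToeplitzPn.normConst p : ℂ) * ToeplitzPn.monomial p z) ∧
      (∀ (a : (Fin n → ℂ) → ℂ) (ha : ToeplitzPn.IsBoundedSymbol a),
        ToeplitzPn.IsSeparatelyRadial a →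
        (∀ p : ToeplitzPn.J n m,
          IntegrableOn (ToeplitzPn.gammaIntegrand a p) (ToeplitzPn.orthant n)) ∧
        -- `R T_a R^*` is multiplication by `γ_{a,m}`
        (∀ (c : EuclideanSpace ℂ (ToeplitzPn.J n m)) (p : ToeplitzPn.J n m),
          R (ToeplitzPn.toeplitz m ha (R.symm c)) p = ToeplitzPn.gammaSeq a p * c p) ∧
        -- `T_a` is diagonal in the basis `e`
        (∀ p : ToeplitzPn.J n m,
          ToeplitzPn.toeplitz m ha (e p) = ToeplitzPn.gammaSeq a p • e p)) ∧
      -- the Toeplitz operators with bounded measurable separately radial symbols commute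
      (∀ (a b : (Fin n → ℂ) → ℂ) (ha : ToeplitzPn.IsBoundedSymbol a)
        (hb : ToeplitzPn.IsBoundedSymbol b),
        ToeplitzPn.IsSeparatelyRadial a → ToeplitzPn.IsSeparatelyRadial b →
        ToeplitzPn.toeplitz m ha ∘L ToeplitzPn.toeplitz m hb =
          ToeplitzPn.toeplitz m hb ∘L ToeplitzPn.toeplitz m ha) := by
  refine ⟨(ToeplitzPn.monomialBasis n m).repr, ToeplitzPn.monomialBasis n m, fun ψ p => ?_,
    fun c => ?_, fun p => ?_, fun a ha hr => ⟨fun p => ToeplitzPn.integrableOn_gammaIntegrand ha p,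
      fun c p => ToeplitzPn.repr_toeplitz ha hr c p, fun p => ?_⟩, fun a b ha hb hra hrb => ?_⟩
  · have hconst : ∀ z, (ToeplitzPn.normConst p : ℂ) *
        ((ψ : ToeplitzPn.L2 n m) z * conj (ToeplitzPn.monomial p z)) =
        (ψ : ToeplitzPn.L2 n m) z * conj (ToeplitzPn.normalizedMonomial p z) := by
      intro z
      rw [ToeplitzPn.normalizedMonomial, map_mul, Complex.conj_ofReal]
      ring
    have hne : (ToeplitzPn.normConst p : ℂ) ≠ 0 := ToeplitzPn.normConst_ne_zero p
    have hint : Integrable (fun z => (ψ : ToeplitzPn.L2 n m) z *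
        conj (ToeplitzPn.normalizedMonomial p z)) (ToeplitzPn.nu n m) :=
      -- A product of two square-integrable functions is integrable, by Hölder.
      (Lp.memLp (ψ : ToeplitzPn.L2 n m)).integrable_mul
        (ToeplitzPn.memLp_normalizedMonomial p).star
    constructor
    · refine (hint.const_mul (ToeplitzPn.normConst p : ℂ)⁻¹).congr
        (Eventually.of_forall fun z => ?_)
      simp only
      rw [← hconst, inv_mul_cancel_left₀ hne]
    · rw [OrthonormalBasis.repr_apply_apply, ToeplitzPn.monomialBasis_apply, Submodule.coe_inner,
        L2.inner_def, ← integral_const_mul]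
      refine integral_congr_ae ?_
      filter_upwards [ToeplitzPn.coeFn_basisVector p] with z hz
      rw [hz, hconst]
      rfl
  · rw [← OrthonormalBasis.sum_repr_symm]
    simp only [ToeplitzPn.monomialBasis_apply]
    exact ToeplitzPn.coeFn_sum_smul_basisVector c
  · rw [ToeplitzPn.monomialBasis_apply]
    exact ToeplitzPn.coeFn_basisVector p
  · rw [ToeplitzPn.monomialBasis_apply]
    exact ToeplitzPn.toeplitz_basisVector ha hr p
  -- Both compositions scale each basis vector by the product of the two eigenvalues.
  · refine ContinuousLinearMap.coe_injective
      ((ToeplitzPn.monomialBasis n m).toBasis.ext fun p => ?_)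
    simp only [OrthonormalBasis.coe_toBasis, ToeplitzPn.monomialBasis_apply,
      ContinuousLinearMap.coe_coe, ContinuousLinearMap.comp_apply,
      ToeplitzPn.toeplitz_basisVector ha hra, ToeplitzPn.toeplitz_basisVector hb hrb, map_smul]
    rw [smul_comm]
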